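/- **Logic.** Fix a countably infinite set $\mathsf{Prop}$ of propositional letters and let $\mathcal L$ be the formulas built from letters with $\land,\lor,\to$ ($\land,\lor$ bind tighter than $\to$). $\mathsf{TWJ}^+$ is the set of formulas derivable by modus ponens (from $\varphi$ and $\varphi\to\psi$ infer $\psi$) and adjunction (from $\varphi$ and $\psi$ infer $\varphi\land\psi$) from all instances of $\varphi\to\varphi$; $\varphi\land\psi\to\varphi$; $\varphi\land\psi\to\psi$; $(\varphi\to\psi)\land(\varphi\to\chi)\to(\varphi\to\psi\land\chi)$; $\varphi\to\varphi\lor\psi$; $\psi\to\varphi\lor\psi$; $(\varphi\to\chi)\land(\psi\to\chi)\to(\varphi\lor\psi\to\chi)$; $\varphi\land(\psi\lor\chi)\to(\varphi\land\psi)\lor(\varphi\land\chi)$; $(\varphi\to\psi)\land(\psi\to\chi)\to(\varphi\to\chi)$; $(\varphi\to\psi)\to[(\chi\to\varphi)\to(\chi\to\psi)]$; $(\varphi\to\psi)\to[(\psi\to\chi)\to(\varphi\to\chi)]$. **Tilings.** A Wang tile is a quadruple $t=(t_W,t_E,t_N,t_S)\in\mathbb N^4$. A finite set $\mathcal W$ of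 tiles *tiles* $D\subseteq\mathbb Z^2$ if there is a map $\tau:D\to\mathcal W$ with $\tau_E(m,n)=\tau_W(m+1,n)$ whenever $(m,n),(m+1,n)\in D$, and $\tau_N(m,n)=\tau_S(m,n+1)$ whenever $(m,n),(m,n+1)\in D$. For $k\in\mathbb N$ let $\mathbb O(k)=\{(m,n)\in\mathbb Z^2: 0\le m\le n\le k\}$. **Tiling formula.** Given a finite set $\mathcal W$ of tiles, take pairwise distinct letters $\mathtt x,\mathtt y,\mathtt p_\top$, $\mathtt m_{i,j}$ ($i,j\in\{0,1\}$), and $\mathtt t$ for each $t\in\mathcal W$. Finite conjunctions and disjunctions are formed in any fixed order. Empty conjunctions are omitted, and an empty disjunction stands for the formula $\mathtt m_{0,0}\land\mathtt m_{0,1}$. Put $$\mathtt R(t):=\bigvee_{t'\in\mathcal W,\ t_E=t'_W}\mathtt t',\qquad \mathtt U(t):=\bigvee_{t'\in\mathcal W,\ t_N=t'_S}\mathtt t',$$ $$\mathtt G_{i,j}:=\mathtt m_{i,j}\land\bigvee_{t\in\mathcal W}\big[\mathtt t\land[\mathtt y\to(\mathtt m_{i,j}\lor(\mathtt m_{i,1-j}\land\mathtt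 U(t)))]\big],$$ $$\begin{aligned}\mathtt x':={}&\mathtt x\land\mathtt p_\top\land(\mathtt p_\top\to\mathtt p_\top)\land\bigwedge_{t\in\mathcal W,\ i,j\in\{0,1\}}\big[(\mathtt m_{i,j}\land\mathtt t)\to(\mathtt m_{i,j}\lor(\mathtt m_{1-i,j}\land\mathtt R(t)))\big]\\&\land\bigwedge_{(i,j)\ne(i',j')}\big[(\mathtt m_{i,j}\land\mathtt m_{i',j'})\to(\mathtt m_{0,0}\land\mathtt m_{0,1})\big]\land\bigwedge_{t,t'\in\mathcal W,\ t\ne t'}\big[(\mathtt t\land\mathtt t')\to(\mathtt m_{0,0}\land\mathtt m_{0,1})\big],\end{aligned}$$ $$\mathtt y':=\mathtt y\land\mathtt p_\top\land(\mathtt p_\top\to\mathtt p_\top),\qquad \mathtt m^c_{i,j}:=\mathtt m_{i,1-j}\lor\mathtt m_{1-i,j}\lor\mathtt m_{1-i,1-j},$$ $$\alpha:=\bigwedge_{i,j\in\{0,1\}}(\mathtt m^c_{i,j}\to\mathtt m^c_{i,j}),\qquad \beta_1:=\bigwedge_{i\in\{0,1\}}\big[(\mathtt y'\to\mathtt m^c_{i,i})\to\mathtt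 m^c_{i,1-i}\big],$$ $$\beta_2:=\bigwedge_{i\in\{0,1\}}\big[(\mathtt x'\to\mathtt m^c_{1-i,i})\to\mathtt m^c_{i,i}\big],\qquad \gamma:=\mathtt p_\top\to\bigvee_{i,j\in\{0,1\}}\mathtt G_{i,j},$$ $$\psi_{\mathcal W}:=(\alpha\land\beta_1\land\beta_2\land\gamma\land\mathtt G_{0,0})\to(\mathtt x'\to\mathtt m^c_{1,0}).$$ **Lemma.** For every finite set $\mathcal W$ of Wang tiles: if $\mathsf{TWJ}^+\nvdash\psi_{\mathcal W}$, then $\mathcal W$ tiles $\mathbb O(k)$ for all $k\in\mathbb N$. -/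

import Mathlib

/-! ### Positive relevant formulas and the logic `TWJ⁺` -/

/-- Formulas over a set `P` of propositional letters, built from `∧`, `∨` and `→` only. -/
inductive Formula (P : Type*) where
  | var (p : P) : Formula P
  | and (φ ψ : Formula P) : Formula P
  | or (φ ψ : Formula P) : Formula P
  | imp (φ ψ : Formula P) : Formula P

infixl:75 " ⩓ " => Formula.and
infixl:72 " ⩔ " => Formula.or
infixr:70 " ⟹ " => Formula.imp

/-- `TWJ φ` : the formula `φ` is a theorem of the Hilbert system `TWJ⁺`. -/
inductive TWJ {P : Type*} : Formula P → Prop where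
  | identity (φ : Formula P) : TWJ (φ ⟹ φ)
  | and_left (φ ψ : Formula P) : TWJ (φ ⩓ ψ ⟹ φ)
  | and_right (φ ψ : Formula P) : TWJ (φ ⩓ ψ ⟹ ψ)
  | and_intro (φ ψ χ : Formula P) : TWJ ((φ ⟹ ψ) ⩓ (φ ⟹ χ) ⟹ (φ ⟹ ψ ⩓ χ))
  | or_left (φ ψ : Formula P) : TWJ (φ ⟹ φ ⩔ ψ)
  | or_right (φ ψ : Formula P) : TWJ (ψ ⟹ φ ⩔ ψ)
  | or_elim (φ ψ χ : Formula P) : TWJ ((φ ⟹ χ) ⩓ (ψ ⟹ χ) ⟹ (φ ⩔ ψ ⟹ χ))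
  | distrib (φ ψ χ : Formula P) : TWJ (φ ⩓ (ψ ⩔ χ) ⟹ (φ ⩓ ψ) ⩔ (φ ⩓ χ))
  | hypothetical_syllogism (φ ψ χ : Formula P) : TWJ ((φ ⟹ ψ) ⩓ (ψ ⟹ χ) ⟹ (φ ⟹ χ))
  | prefixing (φ ψ χ : Formula P) : TWJ ((φ ⟹ ψ) ⟹ ((χ ⟹ φ) ⟹ (χ ⟹ ψ)))
  | suffixing (φ ψ χ : Formula P) : TWJ ((φ ⟹ ψ) ⟹ ((ψ ⟹ χ) ⟹ (φ ⟹ χ)))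
  | modus_ponens {φ ψ : Formula P} : TWJ φ → TWJ (φ ⟹ ψ) → TWJ ψ
  | adjunction {φ ψ : Formula P} : TWJ φ → TWJ ψ → TWJ (φ ⩓ ψ)

/-- The conjunction of `φ` and the members of a list (an empty list adds nothing). -/
def Formula.bigAnd {P : Type*} (φ : Formula P) (L : List (Formula P)) : Formula P :=
  L.foldl Formula.and φ

/-- The disjunction of a list; the disjunction of the empty list is `bot`. -/
def Formula.bigOr {P : Type*} (bot : Formula P) : List (Formula P) → Formula P
  | [] => bot
  | φ :: L => L.foldl Formula.or φ

/-! ### Wang tiles -/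

/-- A Wang tile: a square with coloured edges. -/
@[ext] structure WangTile where
  west : ℕ
  east : ℕ
  north : ℕ
  south : ℕ
deriving DecidableEq

/-- `τ` is a tiling of `D ⊆ ℤ²` with tiles from `W`: any two horizontally or vertically adjacent
cells of `D` have matching colours on their common side. -/
def IsTiling (W : Finset WangTile) (D : Set (ℤ × ℤ)) (τ : D → W) : Prop :=
  (∀ (m n : ℤ) (h : (m, n) ∈ D) (h' : (m + 1, n) ∈ D),
    (τ ⟨(m, n), h⟩).val.east = (τ ⟨(m + 1, n), h'⟩).val.west) ∧
  (∀ (m n : ℤ) (h : (m, n) ∈ D) (h' : (m, n + 1) ∈ D),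
    (τ ⟨(m, n), h⟩).val.north = (τ ⟨(m, n + 1), h'⟩).val.south)

/-- `W` tiles `D`. -/
def Tiles (W : Finset WangTile) (D : Set (ℤ × ℤ)) : Prop :=
  ∃ τ : D → W, IsTiling W D τ

/-- The octant `{(m, n) | 0 ≤ m ≤ n ≤ k}`. -/
def octant (k : ℕ) : Set (ℤ × ℤ) :=
  {s | 0 ≤ s.1 ∧ s.1 ≤ s.2 ∧ s.2 ≤ (k : ℤ)}

/-! ### Tiling formulas -/

/-- The propositional letters that occur in the tiling formula of `W`; `m i j` is the letter
`m_{i,j}` for `i, j ∈ {0, 1}`. In `Fin 2`, `1 - i` is the other index. -/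
inductive TilingLetter (W : Finset WangTile) where
  | x : TilingLetter W
  | y : TilingLetter W
  | pTop : TilingLetter W
  | m (i j : Fin 2) : TilingLetter W
  | tile (t : W) : TilingLetter W

namespace Tiling

variable {P : Type*} {W : Finset WangTile}

/-- The four pairs of indices. -/
def idx : List (Fin 2 × Fin 2) := [(0, 0), (0, 1), (1, 0), (1, 1)]

/-- The formula `m_{i,j}`. Here and below, `e` names the letters of the tiling formula by
pairwise distinct elements of the set `P` of propositional letters. -/
def m (e : TilingLetter W ↪ P) (i j : Fin 2) : Formula P := .var (e (.m i j))

/-- The letter of the tile `t`. -/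
def T (e : TilingLetter W ↪ P) (t : W) : Formula P := .var (e (.tile t))

/-- The letter `p_⊤`. -/
def pTop (e : TilingLetter W ↪ P) : Formula P := .var (e .pTop)

/-- The disjunction of a list. The language has no falsum; the contradictory statement
`m_{0,0} ∧ m_{0,1}` about the parity of a point stands for an empty disjunction. -/
def disj (e : TilingLetter W ↪ P) (L : List (Formula P)) : Formula P :=
  Formula.bigOr (m e 0 0 ⩓ m e 0 1) L

/-- `R(t)`: the permissible rightward neighbours of `t`. The list `l` enumerates `W`. -/
def R (e : TilingLetter W ↪ P) (l : List W) (t : W) : Formula P :=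
  disj e ((l.filter fun t' => t.val.east = t'.val.west).map (T e))

/-- `U(t)`: the permissible upward neighbours of `t`. -/
def U (e : TilingLetter W ↪ P) (l : List W) (t : W) : Formula P :=
  disj e ((l.filter fun t' => t.val.north = t'.val.south).map (T e))

/-- The grid formula `G_{i,j}`. -/
def G (e : TilingLetter W ↪ P) (l : List W) (i j : Fin 2) : Formula P :=
  m e i j ⩓ disj e (l.map fun t =>
    T e t ⩓ (.var (e .y) ⟹ m e i j ⩔ (m e i (1 - j) ⩓ U e l t)))

/-- The formula `x'`. -/
def x' (e : TilingLetter W ↪ P) (l : List W) : Formula P :=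
  Formula.bigAnd (.var (e .x) ⩓ pTop e ⩓ (pTop e ⟹ pTop e))
    ((l.flatMap fun t => idx.map fun a =>
        m e a.1 a.2 ⩓ T e t ⟹ m e a.1 a.2 ⩔ (m e (1 - a.1) a.2 ⩓ R e l t)) ++
     (idx.flatMap fun a => (idx.filter fun b => a ≠ b).map fun b =>
        m e a.1 a.2 ⩓ m e b.1 b.2 ⟹ m e 0 0 ⩓ m e 0 1) ++
     (l.flatMap fun t => (l.filter fun t' => t ≠ t').map fun t' =>
        T e t ⩓ T e t' ⟹ m e 0 0 ⩓ m e 0 1))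

/-- The formula `y'`. -/
def y' (e : TilingLetter W ↪ P) : Formula P :=
  .var (e .y) ⩓ pTop e ⩓ (pTop e ⟹ pTop e)

/-- The notational complement `m_{i,j}^c`. -/
def mc (e : TilingLetter W ↪ P) (i j : Fin 2) : Formula P :=
  m e i (1 - j) ⩔ m e (1 - i) j ⩔ m e (1 - i) (1 - j)

def α (e : TilingLetter W ↪ P) : Formula P :=
  (mc e 0 0 ⟹ mc e 0 0) ⩓ (mc e 0 1 ⟹ mc e 0 1) ⩓
  (mc e 1 0 ⟹ mc e 1 0) ⩓ (mc e 1 1 ⟹ mc e 1 1)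

def β₁ (e : TilingLetter W ↪ P) : Formula P :=
  ((y' e ⟹ mc e 0 0) ⟹ mc e 0 1) ⩓ ((y' e ⟹ mc e 1 1) ⟹ mc e 1 0)

def β₂ (e : TilingLetter W ↪ P) (l : List W) : Formula P :=
  ((x' e l ⟹ mc e 1 0) ⟹ mc e 0 0) ⩓ ((x' e l ⟹ mc e 0 1) ⟹ mc e 1 1)

def γ (e : TilingLetter W ↪ P) (l : List W) : Formula P :=
  pTop e ⟹ G e l 0 0 ⩔ G e l 0 1 ⩔ G e l 1 0 ⩔ G e l 1 1

/-- The tiling formula `ψ_W`, with the finite conjunctions and disjunctions over `W` formed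
along the list `l`. -/
def ψ (e : TilingLetter W ↪ P) (l : List W) : Formula P :=
  α e ⩓ β₁ e ⩓ β₂ e l ⩓ γ e l ⩓ G e l 0 0 ⟹ (x' e l ⟹ mc e 1 0)

end Tiling

/-! ### Derivability -/

namespace TWJ

variable {P : Type*} {φ ψ χ θ : Formula P}

/-! Work in the canonical model: points are prime theories and `Rel a b c` says that applying `a` to
`b` lands in `c`. An unprovable tiling formula yields a point `a` containing the antecedent and a
point to its right that avoids `mc e 1 0`. From there `β₁` and `β₂` alternately supply steps up and
right, a staircase along the diagonal (`Avoids.exists_rel`). The frame conditions of prefixing and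
suffixing close each corner: they complete a right step followed by an up step to a square, so every
new row is filled in from right to left (`IsRow.exists_next`). `γ` puts a tile on each point reached
from `a`. The conjuncts of `x'`, evaluated along right steps, make parities and tiles unique and
match colours. There is no negation, so contradictions are refuted by the avoided disjunctions `mc`.
The rows never end, so a single grid serves all octants. -/

theorem trans (h₁ : TWJ (φ ⟹ ψ)) (h₂ : TWJ (ψ ⟹ χ)) : TWJ (φ ⟹ χ) :=
  modus_ponens (adjunction h₁ h₂) (hypothetical_syllogism _ _ _)

theorem imp_and (h₁ : TWJ (φ ⟹ ψ)) (h₂ : TWJ (φ ⟹ χ)) : TWJ (φ ⟹ ψ ⩓ χ) :=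
  modus_ponens (adjunction h₁ h₂) (and_intro _ _ _)

theorem or_imp (h₁ : TWJ (φ ⟹ χ)) (h₂ : TWJ (ψ ⟹ χ)) : TWJ (φ ⩔ ψ ⟹ χ) :=
  modus_ponens (adjunction h₁ h₂) (or_elim _ _ _)

theorem and_mono (h₁ : TWJ (φ ⟹ ψ)) (h₂ : TWJ (χ ⟹ θ)) : TWJ (φ ⩓ χ ⟹ ψ ⩓ θ) :=
  imp_and ((and_left _ _).trans h₁) ((and_right _ _).trans h₂)

theorem or_mono (h₁ : TWJ (φ ⟹ ψ)) (h₂ : TWJ (χ ⟹ θ)) : TWJ (φ ⩔ χ ⟹ ψ ⩔ θ) :=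
  or_imp (h₁.trans (or_left _ _)) (h₂.trans (or_right _ _))

theorem imp_mono_right (h : TWJ (φ ⟹ ψ)) : TWJ ((χ ⟹ φ) ⟹ (χ ⟹ ψ)) :=
  modus_ponens h (prefixing _ _ _)

theorem imp_mono_left (h : TWJ (φ ⟹ ψ)) : TWJ ((ψ ⟹ χ) ⟹ (φ ⟹ χ)) :=
  modus_ponens h (suffixing _ _ _)

end TWJ

/-! ### Theories and prime theories -/

/-- A set of formulas closed under provable implications and conjunctions. -/
structure IsTheory {P : Type*} (F : Set (Formula P)) : Prop where
  mem_of_imp {φ ψ : Formula P} : TWJ (φ ⟹ ψ) → φ ∈ F → ψ ∈ F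
  and_mem {φ ψ : Formula P} : φ ∈ F → ψ ∈ F → φ ⩓ ψ ∈ F

/-- A theory that contains a member of each disjunction it contains. -/
structure PrimeTheory (P : Type*) where
  carrier : Set (Formula P)
  isTheory : IsTheory carrier
  prime {φ ψ : Formula P} : φ ⩔ ψ ∈ carrier → φ ∈ carrier ∨ ψ ∈ carrier

namespace PrimeTheory

variable {P : Type*} {φ ψ χ : Formula P}

instance : Membership (Formula P) (PrimeTheory P) := ⟨fun p φ => φ ∈ p.carrier⟩

theorem mem_of_imp (p : PrimeTheory P) (h : TWJ (φ ⟹ ψ)) (hφ : φ ∈ p) : ψ ∈ p :=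
  p.isTheory.mem_of_imp h hφ

theorem and_mem_iff {p : PrimeTheory P} : φ ⩓ ψ ∈ p ↔ φ ∈ p ∧ ψ ∈ p :=
  ⟨fun h => ⟨p.mem_of_imp (.and_left _ _) h, p.mem_of_imp (.and_right _ _) h⟩,
    fun h => p.isTheory.and_mem h.1 h.2⟩

theorem or_mem_iff {p : PrimeTheory P} : φ ⩔ ψ ∈ p ↔ φ ∈ p ∨ ψ ∈ p :=
  ⟨fun h => p.prime h, fun h => h.elim (p.mem_of_imp (.or_left _ _)) (p.mem_of_imp (.or_right _ _))⟩

theorem bigAnd_mem_iff {p : PrimeTheory P} (L : List (Formula P)) :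
    Formula.bigAnd φ L ∈ p ↔ φ ∈ p ∧ ∀ ψ ∈ L, ψ ∈ p := by
  induction L generalizing φ with
  | nil => simp [Formula.bigAnd]
  | cons χ L ih =>
    have := ih (φ := φ ⩓ χ)
    simp only [Formula.bigAnd, List.foldl_cons] at this ⊢
    rw [this, and_mem_iff]
    simp [and_assoc]

theorem mem_of_foldl_or_mem {p : PrimeTheory P} (L : List (Formula P)) :
    L.foldl Formula.or φ ∈ p → φ ∈ p ∨ ∃ ψ ∈ L, ψ ∈ p := by
  induction L generalizing φ with
  | nil => exact Or.inl
  | cons χ L ih =>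
    intro h
    rcases ih h with h | ⟨ψ, hL, h⟩
    · rcases or_mem_iff.1 h with h | h
      · exact .inl h
      · exact .inr ⟨χ, by simp, h⟩
    · exact .inr ⟨ψ, by simp [hL], h⟩

theorem mem_of_bigOr_mem {p : PrimeTheory P} {bot : Formula P} {L : List (Formula P)}
    (h : Formula.bigOr bot L ∈ p) : bot ∈ p ∨ ∃ ψ ∈ L, ψ ∈ p := by
  cases L with
  | nil => exact .inl h
  | cons φ L =>
    rcases mem_of_foldl_or_mem L h with h | ⟨ψ, hL, h⟩
    · exact .inr ⟨φ, by simp, h⟩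
    · exact .inr ⟨ψ, by simp [hL], h⟩

/-- Prime extension: a theory disjoint from a set closed under provable antecedents and
disjunctions extends to a prime theory disjoint from it. -/
theorem exists_extension {F I : Set (Formula P)} (hF : IsTheory F)
    (hI : ∀ {φ ψ}, TWJ (φ ⟹ ψ) → ψ ∈ I → φ ∈ I) (hI' : ∀ {φ ψ}, φ ∈ I → ψ ∈ I → φ ⩔ ψ ∈ I)
    (hFI : Disjoint F I) : ∃ p : PrimeTheory P, F ⊆ p.carrier ∧ Disjoint p.carrier I := by
  -- Theories need not contain theorems, so the empty set is one; the maximality argument below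
  -- needs a member of `M`.
  rcases F.eq_empty_or_nonempty with rfl | hne
  · exact ⟨⟨∅, hF, fun h => h.elim⟩, subset_rfl, hFI⟩
  obtain ⟨M, hFM, hM⟩ := zorn_subset_nonempty {S : Set (Formula P) | IsTheory S ∧ Disjoint S I}
    (by
      intro c hc hchain hne
      refine ⟨⋃₀ c, ⟨⟨?_, ?_⟩, Set.disjoint_sUnion_left.2 fun S hS => (hc hS).2⟩,
        fun S hS => Set.subset_sUnion_of_mem hS⟩
      · rintro φ ψ h ⟨S, hS, hφ⟩
        exact ⟨S, hS, (hc hS).1.mem_of_imp h hφ⟩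
      · rintro φ ψ ⟨S, hS, hφ⟩ ⟨S', hS', hψ⟩
        rcases hchain.total hS hS' with h | h
        · exact ⟨S', hS', (hc hS').1.and_mem (h hφ) hψ⟩
        · exact ⟨S, hS, (hc hS).1.and_mem hφ (h hψ)⟩) F ⟨hF, hFI⟩
  obtain ⟨⟨hMT, hMI⟩, hmax⟩ := hM
  obtain ⟨θ₀, hθ₀⟩ := hne.mono hFM
  have key : ∀ φ ∉ M, ∃ θ ∈ M, θ ⩓ φ ∈ I := by
    intro φ hφ
    by_contra! hcon
    let N : Set (Formula P) := {χ | ∃ θ ∈ M, TWJ (θ ⩓ φ ⟹ χ)}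
    have hN : IsTheory N := by
      refine ⟨?_, ?_⟩
      · rintro χ ψ h ⟨θ, hθ, h'⟩
        exact ⟨θ, hθ, h'.trans h⟩
      · rintro χ ψ ⟨θ, hθ, h⟩ ⟨θ', hθ', h'⟩
        exact ⟨θ ⩓ θ', hMT.and_mem hθ hθ',
          .imp_and ((TWJ.and_mono (.and_left _ _) (.identity _)).trans h)
            ((TWJ.and_mono (.and_right _ _) (.identity _)).trans h')⟩
    have hNI : Disjoint N I := Set.disjoint_left.2 fun χ ⟨θ, hθ, h⟩ hχ => hcon θ hθ (hI h hχ)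
    have hMN : M ⊆ N := fun χ hχ => ⟨χ, hχ, .and_left _ _⟩
    exact hφ (hmax ⟨hN, hNI⟩ hMN ⟨θ₀, hθ₀, .and_right _ _⟩)
  refine ⟨⟨M, hMT, fun {φ ψ} h => ?_⟩, hFM, hMI⟩
  by_contra! hcon
  obtain ⟨θ, hθ, h₁⟩ := key φ hcon.1
  obtain ⟨θ', hθ', h₂⟩ := key ψ hcon.2
  refine Set.disjoint_left.1 hMI (hMT.and_mem (hMT.and_mem hθ hθ') h) ?_
  exact hI ((TWJ.distrib _ _ _).trans (.or_mono (.and_mono (.and_left _ _) (.identity _))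
    (.and_mono (.and_right _ _) (.identity _)))) (hI' h₁ h₂)

/-- The canonical ternary relation. -/
def Rel (a b c : PrimeTheory P) : Prop :=
  ∀ ⦃φ ψ⦄, φ ⟹ ψ ∈ a → φ ∈ b → ψ ∈ c

/-- The application of a theory to a set of formulas. -/
def app (a : PrimeTheory P) (B : Set (Formula P)) : Set (Formula P) :=
  {ψ | ∃ φ ∈ B, φ ⟹ ψ ∈ a}

theorem isTheory_app (a : PrimeTheory P) {B : Set (Formula P)} (hB : IsTheory B) :
    IsTheory (a.app B) := by
  refine ⟨?_, ?_⟩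
  · rintro φ ψ h ⟨χ, hχ, h'⟩
    exact ⟨χ, hχ, a.mem_of_imp h.imp_mono_right h'⟩
  · rintro φ ψ ⟨χ, hχ, h⟩ ⟨χ', hχ', h'⟩
    refine ⟨χ ⩓ χ', hB.and_mem hχ hχ', a.mem_of_imp (.and_intro _ _ _) (and_mem_iff.2 ⟨?_, ?_⟩)⟩
    · exact a.mem_of_imp (TWJ.and_left _ _).imp_mono_left h
    · exact a.mem_of_imp (TWJ.and_right _ _).imp_mono_left h'

/-- If the application of `a` to a theory `B` lies in `c`, then `B` extends to a prime theory with
the same property. -/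
theorem exists_rel {a c : PrimeTheory P} {B : Set (Formula P)} (hB : IsTheory B)
    (h : a.app B ⊆ c.carrier) : ∃ b : PrimeTheory P, B ⊆ b.carrier ∧ Rel a b c := by
  obtain ⟨b, hBb, hb⟩ := exists_extension (I := {φ | ∃ ψ, ψ ∉ c ∧ φ ⟹ ψ ∈ a}) hB
    (by
      rintro φ ψ h ⟨χ, hχ, h'⟩
      exact ⟨χ, hχ, a.mem_of_imp h.imp_mono_left h'⟩)
    (by
      rintro φ ψ ⟨χ, hχ, h⟩ ⟨χ', hχ', h'⟩
      refine ⟨χ ⩔ χ', fun h => (or_mem_iff.1 h).elim hχ hχ',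
        a.mem_of_imp (.or_elim _ _ _) (and_mem_iff.2 ⟨?_, ?_⟩)⟩
      · exact a.mem_of_imp (TWJ.or_left _ _).imp_mono_right h
      · exact a.mem_of_imp (TWJ.or_right _ _).imp_mono_right h')
    (Set.disjoint_left.2 fun φ hφ ⟨ψ, hψ, h'⟩ => hψ (h ⟨φ, hφ, h'⟩))
  refine ⟨b, hBb, fun φ ψ h' hφ => ?_⟩
  by_contra hψ
  exact Set.disjoint_left.1 hb hφ ⟨ψ, hψ, h'⟩

theorem exists_notMem {F : Set (Formula P)} (hF : IsTheory F) (hφ : φ ∉ F) :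
    ∃ p : PrimeTheory P, F ⊆ p.carrier ∧ φ ∉ p := by
  obtain ⟨p, hFp, hp⟩ := exists_extension (I := {ψ | TWJ (ψ ⟹ φ)}) hF
    (fun h h' => h.trans h') (fun h h' => h.or_imp h')
    (Set.disjoint_left.2 fun ψ hψ h => hφ (hF.mem_of_imp h hψ))
  exact ⟨p, hFp, Set.disjoint_right.1 hp (.identity φ)⟩

theorem isTheory_consequences (φ : Formula P) : IsTheory {ψ | TWJ (φ ⟹ ψ)} :=
  ⟨fun h h' => TWJ.trans h' h, fun h h' => TWJ.imp_and h h'⟩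

theorem exists_of_not_derivable (h : ¬ TWJ (φ ⟹ ψ)) : ∃ p : PrimeTheory P, φ ∈ p ∧ ψ ∉ p := by
  obtain ⟨p, hp, hψ⟩ := exists_notMem (isTheory_consequences φ) h
  exact ⟨p, hp (.identity φ), hψ⟩

theorem exists_rel_of_imp_notMem {a : PrimeTheory P} (h : φ ⟹ ψ ∉ a) :
    ∃ b c, Rel a b c ∧ φ ∈ b ∧ ψ ∉ c := by
  obtain ⟨c, hc, hψ⟩ := exists_notMem (a.isTheory_app (isTheory_consequences φ)) (φ := ψ) (by
    rintro ⟨χ, hχ, h'⟩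
    exact h (a.mem_of_imp (TWJ.imp_mono_left hχ) h'))
  obtain ⟨b, hb, hR⟩ := exists_rel (isTheory_consequences φ) hc
  exact ⟨b, c, hR, hb (.identity φ), hψ⟩

/-! ### Frame conditions and what they transport -/

variable {a b c d e : PrimeTheory P}

theorem Rel.prefixing (h₁ : Rel a b e) (h₂ : Rel e c d) : ∃ f, Rel b c f ∧ Rel a f d := by
  obtain ⟨f, hf, hR⟩ := exists_rel (a := a) (c := d) (b.isTheory_app c.isTheory) (by
    rintro ψ ⟨φ, ⟨χ, hχ, hb⟩, ha⟩
    exact h₂ (h₁ (a.mem_of_imp (.prefixing _ _ _) ha) hb) hχ)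
  exact ⟨f, fun φ ψ h hφ => hf ⟨φ, hφ, h⟩, hR⟩

theorem Rel.suffixing (h₁ : Rel a b e) (h₂ : Rel e c d) : ∃ f, Rel a c f ∧ Rel b f d := by
  obtain ⟨f, hf, hR⟩ := exists_rel (a := b) (c := d) (a.isTheory_app c.isTheory) (by
    rintro ψ ⟨φ, ⟨χ, hχ, hb⟩, ha⟩
    exact h₂ (h₁ (a.mem_of_imp (.suffixing _ _ _) hb) ha) hχ)
  exact ⟨f, fun φ ψ h hφ => hf ⟨φ, hφ, h⟩, hR⟩

theorem Rel.hypothetical_syllogism (h : Rel a b c) : ∃ f, Rel a b f ∧ Rel a f c := by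
  obtain ⟨f, hf, hR⟩ := exists_rel (a := a) (c := c) (a.isTheory_app b.isTheory) (by
    rintro ψ ⟨φ, ⟨χ, hχ, hb⟩, ha⟩
    exact h (a.mem_of_imp (.hypothetical_syllogism _ _ _) (and_mem_iff.2 ⟨hb, ha⟩)) hχ)
  exact ⟨f, fun φ ψ h hφ => hf ⟨φ, hφ, h⟩, hR⟩

/-- The application of `a` to `b` can be continued, relative to `a`, to a prime theory without
`φ`. -/
def Avoids (a b : PrimeTheory P) (φ : Formula P) : Prop :=
  ∃ c, Rel a b c ∧ φ ∉ c

theorem Avoids.notMem (h : Avoids a b φ) (ha : φ ⟹ φ ∈ a) : φ ∉ b := by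
  obtain ⟨c, hR, hc⟩ := h
  exact fun hb => hc (hR ha hb)

/-- Avoidance, unlike mere non-membership, reproduces itself: hypothetical syllogism inserts an
intermediate `f` where `χ ⟹ ψ` fails, and prefixing turns the failure at `f` into a step from `b`
itself. -/
theorem Avoids.exists_rel (h : Avoids a b φ) (ha : (χ ⟹ ψ) ⟹ φ ∈ a) :
    ∃ s b', χ ∈ s ∧ Rel b s b' ∧ Avoids a b' ψ := by
  obtain ⟨c, hR, hc⟩ := h
  obtain ⟨f, hbf, hfc⟩ := hR.hypothetical_syllogism
  obtain ⟨s, z, hs, hχ, hψ⟩ := exists_rel_of_imp_notMem fun h => hc (hfc ha h)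
  obtain ⟨b', hb', hz⟩ := hbf.prefixing hs
  exact ⟨s, b', hχ, hb', z, hz, hψ⟩

theorem Rel.exists_avoids (h : Rel a b c) (hφ : φ ∉ c) : ∃ f, Rel a b f ∧ Avoids a f φ := by
  obtain ⟨f, h₁, h₂⟩ := h.hypothetical_syllogism
  exact ⟨f, h₁, c, h₂, hφ⟩

/-- `b` is `a` itself, or contains the application of `a` to a theory containing `φ` and
`φ ⟹ φ`. -/
def Reaches (φ : Formula P) (a b : PrimeTheory P) : Prop :=
  b = a ∨ ∃ q, Rel a q b ∧ φ ∈ q ∧ φ ⟹ φ ∈ q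

/-- This is the purpose of the conjunct `p_⊤ → p_⊤` in `x'` and `y'`: it passes both itself and
`p_⊤` on to the composite point, so `γ` stays applicable after any number of steps. -/
theorem Reaches.rel (h : Reaches φ a b) (hR : Rel b c d) (hc : φ ∈ c) (hc' : φ ⟹ φ ∈ c) :
    ∃ q, Rel a q d ∧ φ ∈ q ∧ φ ⟹ φ ∈ q := by
  rcases h with rfl | ⟨q, hq, hφ, hφ'⟩
  · exact ⟨c, hR, hc, hc'⟩
  · obtain ⟨f, h₁, h₂⟩ := hq.prefixing hR
    exact ⟨f, h₂, h₁ hφ' hc, h₁ (q.mem_of_imp (.prefixing _ _ _) hφ') hc'⟩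

end PrimeTheory

/-! ### The tiling formula in prime theories -/

namespace Tiling

open PrimeTheory

theorem one_sub_one_sub (i : Fin 2) : 1 - (1 - i) = i := by
  revert i; decide

theorem one_sub_ne (i : Fin 2) : 1 - i ≠ i := by
  revert i; decide

theorem eq_or_eq_one_sub (i j : Fin 2) : i = j ∨ i = 1 - j := by
  revert i j; decide

variable {P : Type*} {W : Finset WangTile} {e : TilingLetter W ↪ P} {l : List W}
  {a p w v x y : PrimeTheory P} {i j i' j' : Fin 2} {t t' : W}

theorem notMem_of_mc_notMem (h : mc e i j ∉ p) :
    m e i (1 - j) ∉ p ∧ m e (1 - i) j ∉ p ∧ m e (1 - i) (1 - j) ∉ p := by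
  simpa only [mc, or_mem_iff, not_or, and_assoc] using h

/-- Each `mc` omits only one of the four parity letters, so it follows from `m_{0,0}` or from
`m_{0,1}`. -/
theorem bot_notMem (h : mc e i j ∉ p) : m e 0 0 ⩓ m e 0 1 ∉ p := by
  intro hb
  obtain ⟨h₀, h₁⟩ := and_mem_iff.1 hb
  obtain ⟨h₂, h₃, h₄⟩ := notMem_of_mc_notMem h
  fin_cases i <;> fin_cases j <;> simp_all

theorem exists_mem_of_disj_mem {L : List W} {f : W → Formula P} (h : disj e (L.map f) ∈ p)
    (hb : m e 0 0 ⩓ m e 0 1 ∉ p) : ∃ t ∈ L, f t ∈ p := by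
  rcases mem_of_bigOr_mem h with h | ⟨φ, hφ, h⟩
  · exact (hb h).elim
  · obtain ⟨t, ht, rfl⟩ := List.mem_map.1 hφ
    exact ⟨t, ht, h⟩

/-- The point `p` has parity `(i, j)` and carries the tile `t`. -/
def Labelled (e : TilingLetter W ↪ P) (l : List W) (i j : Fin 2) (t : W) (p : PrimeTheory P) :
    Prop :=
  m e i j ∈ p ∧ T e t ∈ p ∧ (.var (e .y) ⟹ m e i j ⩔ (m e i (1 - j) ⩓ U e l t)) ∈ p

/-- With `l` nonempty no falsum disjunct occurs, so consistency of `p` is not needed. -/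
theorem exists_labelled (hl : l ≠ []) (h : G e l i j ∈ p) : ∃ t, Labelled e l i j t p := by
  obtain ⟨hm, h⟩ := and_mem_iff.1 h
  obtain ⟨s, L, rfl⟩ := List.exists_cons_of_ne_nil hl
  have : ∃ φ ∈ (s :: L).map (fun t => T e t ⩓
      (.var (e .y) ⟹ m e i j ⩔ (m e i (1 - j) ⩓ U e (s :: L) t))), φ ∈ p := by
    rcases mem_of_foldl_or_mem _ h with h | ⟨φ, hφ, h⟩
    · exact ⟨_, List.mem_cons_self, h⟩
    · exact ⟨φ, List.mem_cons_of_mem _ hφ, h⟩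
  obtain ⟨φ, hφ, h⟩ := this
  obtain ⟨t, -, rfl⟩ := List.mem_map.1 hφ
  exact ⟨t, hm, and_mem_iff.1 h⟩

theorem y'_mem (h : y' e ∈ y) :
    Formula.var (e .y) ∈ y ∧ pTop e ∈ y ∧ pTop e ⟹ pTop e ∈ y := by
  simpa only [y', and_mem_iff, and_assoc] using h

theorem x'_mem (h : x' e l ∈ x) : pTop e ∈ x ∧ pTop e ⟹ pTop e ∈ x := by
  have := ((bigAnd_mem_iff _).1 h).1
  simp only [and_mem_iff, and_assoc] at this
  exact this.2

theorem mem_idx (a : Fin 2 × Fin 2) : a ∈ idx := by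
  revert a; decide

theorem rel_horizontal (hl : ∀ t, t ∈ l) (hx : x' e l ∈ x) (hR : Rel x w v)
    (hm : m e i j ∈ w) (ht : T e t ∈ w) :
    m e i j ∈ v ∨ m e (1 - i) j ∈ v ∧ R e l t ∈ v := by
  have := ((bigAnd_mem_iff _).1 hx).2
    (m e i j ⩓ T e t ⟹ m e i j ⩔ (m e (1 - i) j ⩓ R e l t))
    (List.mem_append_left _ (List.mem_append_left _ (List.mem_flatMap.2
      ⟨t, hl t, List.mem_map.2 ⟨(i, j), mem_idx _, rfl⟩⟩)))
  simpa only [or_mem_iff, and_mem_iff] using hR this (and_mem_iff.2 ⟨hm, ht⟩)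

/-- A clash at `w` is seen only at its right neighbour `v`, where it would produce the stand-in for
falsum. -/
theorem parity_unique (hx : x' e l ∈ x) (hR : Rel x w v) (hv : m e 0 0 ⩓ m e 0 1 ∉ v)
    (h : m e i j ∈ w) (h' : m e i' j' ∈ w) : i = i' ∧ j = j' := by
  by_contra hne
  have := ((bigAnd_mem_iff _).1 hx).2 (m e i j ⩓ m e i' j' ⟹ m e 0 0 ⩓ m e 0 1)
    (List.mem_append_left _ (List.mem_append_right _ (List.mem_flatMap.2
      ⟨(i, j), mem_idx _, List.mem_map.2 ⟨(i', j'), List.mem_filter.2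
        ⟨mem_idx _, by simpa [imp_iff_not_or] using hne⟩, rfl⟩⟩)))
  exact hv (hR this (and_mem_iff.2 ⟨h, h'⟩))

theorem tile_unique (hl : ∀ t, t ∈ l) (hx : x' e l ∈ x) (hR : Rel x w v)
    (hv : m e 0 0 ⩓ m e 0 1 ∉ v) (h : T e t ∈ w) (h' : T e t' ∈ w) : t = t' := by
  by_contra hne
  have := ((bigAnd_mem_iff _).1 hx).2 (T e t ⩓ T e t' ⟹ m e 0 0 ⩓ m e 0 1)
    (List.mem_append_right _ (List.mem_flatMap.2
      ⟨t, hl t, List.mem_map.2 ⟨t', List.mem_filter.2 ⟨hl t', by simpa using hne⟩, rfl⟩⟩))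
  exact hv (hR this (and_mem_iff.2 ⟨h, h'⟩))

/-- A point above `p` with a right neighbour of the expected parity has the expected parity, and
its tile matches that of `p`. -/
theorem labelled_above (hl : ∀ t, t ∈ l) (hp : Labelled e l i j t p) (hy : y' e ∈ y)
    (hpw : Rel p y w) (hw : Labelled e l i' j' t' w) (hx : x' e l ∈ x) (hwv : Rel x w v)
    (hv : mc e (1 - i) (1 - j) ∉ v) :
    i' = i ∧ j' = 1 - j ∧ mc e i (1 - j) ∉ w ∧ t.val.north = t'.val.south := by
  have hb := bot_notMem hv
  obtain ⟨h₁, h₂, h₃⟩ := notMem_of_mc_notMem hv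
  simp only [one_sub_one_sub] at h₁ h₂ h₃
  have hbw : m e 0 0 ⩓ m e 0 1 ∉ w := fun h => by
    obtain ⟨h, h'⟩ := and_mem_iff.1 h
    exact absurd (parity_unique hx hwv hb h h').2 (by decide)
  rcases or_mem_iff.1 (hpw hp.2.2 (y'_mem hy).1) with h | h
  -- If the vertical parity had not flipped, `v` would contain a letter with the old vertical
  -- parity, against `hv`.
  · rcases rel_horizontal hl hx hwv h hw.2.1 with h | h
    · exact (h₃ h).elim
    · exact (h₁ h.1).elim
  · obtain ⟨hm, hU⟩ := and_mem_iff.1 h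
    obtain ⟨rfl, rfl⟩ := parity_unique hx hwv hb hw.1 hm
    refine ⟨rfl, rfl, ?_, ?_⟩
    · simp only [mc, or_mem_iff, not_or, one_sub_one_sub]
      exact ⟨⟨fun h => one_sub_ne _ (parity_unique hx hwv hb hm h).2,
        fun h => one_sub_ne _ (parity_unique hx hwv hb h hm).1⟩,
        fun h => one_sub_ne _ (parity_unique hx hwv hb h hm).1⟩
    · obtain ⟨s, hs, hsw⟩ := exists_mem_of_disj_mem hU hbw
      rw [← tile_unique hl hx hwv hb hsw hw.2.1]
      simpa using (List.mem_filter.1 hs).2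

theorem labelled_right (hl : ∀ t, t ∈ l) (hw : Labelled e l i j t w) (hx : x' e l ∈ x)
    (hwv : Rel x w v) (hv' : mc e (1 - i) j ∉ v)
    (hu : ∀ s, T e s ∈ v → s = t') : t.val.east = t'.val.west := by
  rcases rel_horizontal hl hx hwv hw.1 hw.2.1 with h | h
  · have := (notMem_of_mc_notMem hv').2.1
    rw [one_sub_one_sub] at this
    exact (this h).elim
  · obtain ⟨s, hs, hsv⟩ := exists_mem_of_disj_mem h.2 (bot_notMem hv')
    rw [← hu s hsv]
    simpa using (List.mem_filter.1 hs).2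

/-! ### The grid -/

/-- The antecedent of the tiling formula. -/
def antecedent (e : TilingLetter W ↪ P) (l : List W) : Formula P :=
  α e ⩓ β₁ e ⩓ β₂ e l ⩓ γ e l ⩓ G e l 0 0

theorem α_mem (h : antecedent e l ∈ a) (i j : Fin 2) : mc e i j ⟹ mc e i j ∈ a := by
  simp only [antecedent, α, and_mem_iff] at h
  fin_cases i <;> fin_cases j <;> simp_all

theorem β₁_mem (h : antecedent e l ∈ a) (i : Fin 2) :
    (y' e ⟹ mc e i i) ⟹ mc e i (1 - i) ∈ a := by
  simp only [antecedent, β₁, and_mem_iff] at h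
  fin_cases i <;> simp_all

theorem β₂_mem (h : antecedent e l ∈ a) (i : Fin 2) :
    (x' e l ⟹ mc e (1 - i) i) ⟹ mc e i i ∈ a := by
  simp only [antecedent, β₂, and_mem_iff] at h
  fin_cases i <;> simp_all

theorem exists_G_mem (h : antecedent e l ∈ a) (hp : ∃ q, Rel a q p ∧ pTop e ∈ q ∧
    pTop e ⟹ pTop e ∈ q) : ∃ i j, G e l i j ∈ p := by
  obtain ⟨q, hR, hq, -⟩ := hp
  simp only [antecedent, and_mem_iff] at h
  have := hR h.1.2 hq
  simp only [or_mem_iff] at this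
  rcases this with ((h | h) | h) | h <;> exact ⟨_, _, h⟩

theorem exists_labelled_of_mc_notMem (hl : l ≠ []) (h : antecedent e l ∈ a)
    (hp : ∃ q, Rel a q p ∧ pTop e ∈ q ∧ pTop e ⟹ pTop e ∈ q) (hm : mc e i j ∉ p) :
    ∃ t, Labelled e l i j t p := by
  obtain ⟨i', j', h⟩ := exists_G_mem h hp
  have hG := (and_mem_iff.1 h).1
  obtain ⟨h₁, h₂, h₃⟩ := notMem_of_mc_notMem hm
  rcases eq_or_eq_one_sub i' i with rfl | rfl <;> rcases eq_or_eq_one_sub j' j with rfl | rfl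
  · exact exists_labelled hl h
  · exact (h₁ hG).elim
  · exact (h₂ hG).elim
  · exact (h₃ hG).elim

/-- The parity of a natural number. -/
def parity : ℕ → Fin 2
  | 0 => 0
  | n + 1 => 1 - parity n

theorem one_sub_parity_succ (n : ℕ) : 1 - parity (n + 1) = parity n := one_sub_one_sub _

/-- Dependent choice running downwards from `N`, since a row is built leftwards from its diagonal
cell. -/
theorem exists_chain {X : Type*} (Good : ℕ → X → Prop) (S : X → X → Prop) (N : ℕ) (v : X)
    (hv : Good N v) (h : ∀ n < N, ∀ v, Good (n + 1) v → ∃ w, Good n w ∧ S w v) :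
    ∃ f : ℕ → X, f N = v ∧ (∀ n ≤ N, Good n (f n)) ∧ ∀ n < N, S (f n) (f (n + 1)) := by
  induction N generalizing v with
  | zero => exact ⟨fun _ => v, rfl, fun n hn => by rwa [Nat.le_zero.1 hn], fun n hn => by omega⟩
  | succ N ih =>
    obtain ⟨w, hw, hwv⟩ := h N (by omega) v hv
    obtain ⟨f, hf, hG, hS⟩ := ih w hw fun n hn => h n (by omega)
    refine ⟨Function.update f (N + 1) v, by simp, fun n hn => ?_, fun n hn => ?_⟩
    · rcases hn.eq_or_lt with rfl | hn
      · simpa using hv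
      · rw [Function.update_of_ne hn.ne]
        exact hG n (by omega)
    · rw [Function.update_of_ne hn.ne]
      rcases (Nat.lt_succ_iff.1 hn).eq_or_lt with rfl | hn'
      · simpa [hf] using hwv
      · rw [Function.update_of_ne (by omega)]
        exact hS n hn'

/-- The points `r 0, …, r n` represent the cells `(0, n), …, (n, n)`, and `d` represents the cell
`(n + 1, n)`. -/
structure IsRow (e : TilingLetter W ↪ P) (l : List W) (a : PrimeTheory P) (n : ℕ)
    (r : ℕ → PrimeTheory P) (d : PrimeTheory P) : Prop where
  reaches : ∀ k ≤ n, Reaches (pTop e) a (r k)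
  labelled : ∀ k ≤ n, ∃ t, Labelled e l (parity k) (parity n) t (r k)
  rel : ∀ k < n, ∃ x, x' e l ∈ x ∧ Rel x (r k) (r (k + 1))
  notMem : ∀ k < n, mc e (parity (k + 1)) (parity n) ∉ r (k + 1)
  rel_last : ∃ x, x' e l ∈ x ∧ Rel (r n) x d
  reaches_last : Reaches (pTop e) a d
  avoids_last : Avoids a d (mc e (parity (n + 1)) (parity n))

theorem IsRow.exists_next (hl : ∀ t, t ∈ l) (hne : l ≠ []) (ha : antecedent e l ∈ a) {n : ℕ}
    {r : ℕ → PrimeTheory P} {d : PrimeTheory P} (h : IsRow e l a n r d) :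
    ∃ r' d', IsRow e l a (n + 1) r' d' ∧ ∃ y, y' e ∈ y ∧ ∀ k ≤ n, Rel (r k) y (r' k) := by
  -- The staircase: up to the new diagonal cell `c` by `β₁`, then right to `d'` by `β₂`.
  obtain ⟨y, c, hy, hc, hcA⟩ := h.avoids_last.exists_rel (χ := y' e)
    (ψ := mc e (parity (n + 1)) (parity (n + 1)))
    (by simpa only [one_sub_parity_succ] using β₁_mem ha (parity (n + 1)))
  obtain ⟨-, hy₁, hy₂⟩ := y'_mem hy
  obtain ⟨x₂, d', hx₂, hd', hdA⟩ := hcA.exists_rel (χ := x' e l)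
    (ψ := mc e (parity (n + 2)) (parity (n + 1))) (β₂_mem ha (parity (n + 1)))
  have hcR := h.reaches_last.rel hc hy₁ hy₂
  have hcm := hcA.notMem (α_mem ha _ _)
  let Good : ℕ → PrimeTheory P → Prop := fun k w => (k ≤ n → Rel (r k) y w) ∧
    (k = n + 1 → Rel d y w) ∧ Reaches (pTop e) a w ∧
    (∃ t, Labelled e l (parity k) (parity (n + 1)) t w) ∧ mc e (parity k) (parity (n + 1)) ∉ w
  obtain ⟨f, hf, hG, hS⟩ := exists_chain Good (fun w v => ∃ x, x' e l ∈ x ∧ Rel x w v) (n + 1) c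
    ⟨fun h => by omega, fun _ => hc, .inr hcR, exists_labelled_of_mc_notMem hne ha hcR hcm, hcm⟩
    (by
      rintro k hk v ⟨hv₁, hv₂, -, -, hv₃⟩
      have : ∃ w x, x' e l ∈ x ∧ Rel (r k) y w ∧ Rel x w v := by
        rcases (Nat.lt_succ_iff.1 hk).eq_or_lt with rfl | hk'
        -- The last right step has `x` as argument; suffixing moves it to the function position that
        -- the conjuncts of `x'` require. The other steps already have this form, so prefixing
        -- suffices.
        · obtain ⟨x, hx, hR⟩ := h.rel_last
          obtain ⟨w, hw, hw'⟩ := hR.suffixing (hv₂ rfl)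
          exact ⟨w, x, hx, hw, hw'⟩
        · obtain ⟨x, hx, hR⟩ := h.rel k hk'
          obtain ⟨w, hw, hw'⟩ := hR.prefixing (hv₁ hk')
          exact ⟨w, x, hx, hw, hw'⟩
      obtain ⟨w, x, hx, hw, hwv⟩ := this
      have hwR := (h.reaches k (by omega)).rel hw hy₁ hy₂
      obtain ⟨i', j', hwG⟩ := exists_G_mem ha hwR
      obtain ⟨t', ht'⟩ := exists_labelled hne hwG
      obtain ⟨t, ht⟩ := h.labelled k (by omega)
      obtain ⟨rfl, rfl, hwm, -⟩ := labelled_above hl ht hy hw ht' hx hwv hv₃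
      exact ⟨w, ⟨fun _ => hw, fun h => by omega, .inr hwR, ⟨t', ht'⟩, hwm⟩, x, hx, hwv⟩)
  refine ⟨f, d', ⟨fun k hk => (hG k hk).2.2.1, fun k hk => (hG k hk).2.2.2.1, hS,
    fun k hk => (hG (k + 1) hk).2.2.2.2, ⟨x₂, hx₂, hf ▸ hd'⟩, ?_, hdA⟩, y, hy,
    fun k hk => (hG k (by omega)).1 hk⟩
  exact .inr ((Reaches.rel (.inr hcR) hd' (x'_mem hx₂).1 (x'_mem hx₂).2))

theorem exists_isRow_zero (h : ¬ TWJ (ψ e l)) :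
    ∃ a r d, antecedent e l ∈ a ∧ l ≠ [] ∧ IsRow e l a 0 r d := by
  obtain ⟨a, ha, h⟩ := exists_of_not_derivable h
  obtain ⟨x, c, hR, hx, hc⟩ := exists_rel_of_imp_notMem h
  obtain ⟨d, hd, hdA⟩ := hR.exists_avoids hc
  have ha' : antecedent e l ∈ a := ha
  have hdR : ∃ q, Rel a q d ∧ pTop e ∈ q ∧ pTop e ⟹ pTop e ∈ q := ⟨x, hd, x'_mem hx⟩
  have hne : l ≠ [] := by
    -- Without tiles, `γ` would force the falsum stand-in at `d`.
    rintro rfl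
    obtain ⟨i, j, hG⟩ := exists_G_mem ha' hdR
    exact bot_notMem (hdA.notMem (α_mem ha' _ _)) (and_mem_iff.1 hG).2
  refine ⟨a, fun _ => a, d, ha', hne, fun _ _ => .inl rfl, fun k hk => ?_, fun k hk => by omega,
    fun k hk => by omega, ⟨x, hx, hd⟩, .inr hdR, hdA⟩
  rw [Nat.le_zero.1 hk]
  exact exists_labelled hne (and_mem_iff.1 ha').2

theorem exists_grid (hl : ∀ t, t ∈ l) (h : ¬ TWJ (ψ e l)) :
    ∃ g : ℕ → ℕ → W, (∀ k n, k ≤ n → (g k n).val.north = (g k (n + 1)).val.south) ∧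
      ∀ k n, k + 1 ≤ n → (g k n).val.east = (g (k + 1) n).val.west := by
  obtain ⟨a, r₀, d₀, ha, hne, h₀⟩ := exists_isRow_zero h
  choose! r' d' hr' using fun n r d (h : IsRow e l a n r d) => h.exists_next hl hne ha
  let F : ℕ → (ℕ → PrimeTheory P) × PrimeTheory P :=
    fun n => Nat.rec (r₀, d₀) (fun n s => (r' n s.1 s.2, d' n s.1 s.2)) n
  have hF : ∀ n, IsRow e l a n (F n).1 (F n).2 := by
    intro n
    induction n with
    | zero => exact h₀
    | succ n ih => exact (hr' n _ _ ih).1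
  have hV : ∀ n, ∃ y, y' e ∈ y ∧ ∀ k ≤ n, Rel ((F n).1 k) y ((F (n + 1)).1 k) :=
    fun n => (hr' n _ _ (hF n)).2
  -- Cell `(k, n)` is read off row `n + 1`, dropping the diagonal: a diagonal point has no right
  -- neighbour in its row to witness that its tile is unique.
  have hlab : ∀ k n, k ≤ n → ∃ t,
      Labelled e l (parity k) (parity (n + 1)) t ((F (n + 1)).1 k) :=
    fun k n hk => (hF (n + 1)).labelled k (by omega)
  have : Nonempty W := ⟨l.head hne⟩
  choose! g hg using hlab
  refine ⟨g, fun k n hk => ?_, fun k n hk => ?_⟩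
  · obtain ⟨y, hy, hV⟩ := hV (n + 1)
    obtain ⟨x, hx, hR⟩ := (hF (n + 2)).rel k (by omega)
    exact (labelled_above hl (hg k n hk) hy (hV k (by omega)) (hg k (n + 1) (by omega)) hx hR
      ((hF (n + 2)).notMem k (by omega))).2.2.2
  · obtain ⟨x, hx, hR⟩ := (hF (n + 1)).rel k (by omega)
    obtain ⟨x₂, hx₂, hR₂⟩ := (hF (n + 1)).rel (k + 1) (by omega)
    exact labelled_right hl (hg k n (by omega)) hx hR
      ((hF (n + 1)).notMem k (by omega)) fun s hs => tile_unique hl hx₂ hR₂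
        (bot_notMem ((hF (n + 1)).notMem (k + 1) (by omega))) hs (hg (k + 1) n hk).2.1

end Tiling

theorem mainTheorem4 {P : Type*} [Countable P] [Infinite P] (W : Finset WangTile)
    (e : TilingLetter W ↪ P) (l : List W) (hl : ∀ t : W, t ∈ l)
    (h : ¬ TWJ (Tiling.ψ e l)) :
    ∀ k : ℕ, Tiles W (octant k) := by
  obtain ⟨g, hv, hh⟩ := Tiling.exists_grid hl h
  refine fun k => ⟨fun s => g s.val.1.toNat s.val.2.toNat, fun m n h h' => ?_, fun m n h h' => ?_⟩
  · simp only [octant, Set.mem_ofPred_eq] at h h'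
    have := hh m.toNat n.toNat (by omega)
    rwa [show m.toNat + 1 = (m + 1).toNat by omega] at this
  · simp only [octant, Set.mem_ofPred_eq] at h h'
    have := hv m.toNat n.toNat (by omega)
    rwa [show n.toNat + 1 = (n + 1).toNat by omega] at this
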